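/- Let $\alpha\in(0,2)$ and let $m\in L^\alpha(\mathbb R)$ (i.e. $m$ is measurable and $\int_{\mathbb R}|m(x)|^\alpha\,dx<\infty$) be nonnegative. Let $\Lambda$ be a symmetric $\alpha$-stable (S$\alpha$S) random measure on $\mathbb R$ with Lebesgue control measure, that is, an independently scattered, almost surely $\sigma$-additive random set function on the Borel sets $A$ of finite Lebesgue measure $|A|$ with $\mathbb E\,e^{is\Lambda(A)}=\exp(-|A|\,|s|^\alpha)$, $s\in\mathbb R$. Let $X=\{X(t),\,t\in\mathbb R\}$ be the S$\alpha$S moving average $$X(t)=\int_{\mathbb R} m(t-x)\,\Lambda(dx),\qquad t\in\mathbb R,$$ where the stochastic integral of a function in $L^\alpha(\mathbb R)$ is the limit in probability of the integrals of simple functions converging to it in $L^\alpha(\mathbb R)$. Let $a>0$. A stationary process $X=\{X(t),\,t\in\mathbb R\}$ (all finite-dimensional distributions are invariant under translations) is called long range dependent if there is a finite measure $\mu$ on $\mathbb R$ such that $$\int_{\mathbb R}\int_{\mathbb R}\int_{\mathbb R}\bigl|\mathrm{Cov}\bigl(\mathbf 1\{X(0)>u\},\mathbf 1\{X(t)>v\}\bigr)\bigr|\,\mu(du)\,\mu(dv)\,dt=\infty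 .$$ (i) If $m$ is monotonically decreasing on $(a,\infty)$ and $\int_a^\infty t\,m^\alpha(t)\,dt=\infty$, then $X$ is (stationary and) long range dependent. (ii) If $m$ is monotonically increasing on $(-\infty,-a)$ and $\int_{-\infty}^{-a}t\,m^\alpha(t)\,dt=-\infty$, then $X$ is (stationary and) long range dependent. (iii) If $m$ is symmetric, i.e. $m(-x)=m(x)$ for all $x\in\mathbb R$, then $\int_a^\infty t\,m^\alpha(t)\,dt=\infty$ if and only if $\int_{-\infty}^{-a}t\,m^\alpha(t)\,dt=-\infty$. -/

import Mathlib

open MeasureTheory ProbabilityTheory Filter Topology Set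
open scoped ENNReal

/-- `Λ` is a symmetric `α`-stable random measure on `ℝ` with Lebesgue control measure, defined on
the probability space `(Ω, P)`: to every Borel set `A` of finite Lebesgue measure it assigns a
random variable `Λ A` with characteristic function `s ↦ exp (-|A| |s| ^ α)`, it is independently
scattered, and it is `σ`-additive almost surely. The values of `Λ` on other sets are irrelevant.

The series in `sigma_additive` converges in the given order of the sets
(for `α ≥ 1` it need not converge absolutely). -/
structure IsSaSRandomMeasure {Ω : Type*} [MeasurableSpace Ω] (α : ℝ) (P : Measure Ω)
    (Λ : Set ℝ → Ω → ℝ) : Prop where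
  measurable : ∀ A : Set ℝ, MeasurableSet A → volume A < ∞ → Measurable (Λ A)
  charFun_eq : ∀ A : Set ℝ, MeasurableSet A → volume A < ∞ → ∀ s : ℝ,
    charFun (P.map (Λ A)) s = ((Real.exp (-((volume A).toReal * |s| ^ α)) : ℝ) : ℂ)
  indep : ∀ (n : ℕ) (A : Fin n → Set ℝ), (∀ i, MeasurableSet (A i)) →
    (∀ i, volume (A i) < ∞) → (∀ i j, i ≠ j → Disjoint (A i) (A j)) →
    iIndepFun (fun i ↦ Λ (A i)) P
  sigma_additive : ∀ A : ℕ → Set ℝ, (∀ i, MeasurableSet (A i)) →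
    (∀ i j, i ≠ j → Disjoint (A i) (A j)) → volume (⋃ i, A i) < ∞ →
    ∀ᵐ ω ∂P, Tendsto (fun n : ℕ ↦ ∑ i ∈ Finset.range n, Λ (A i) ω) atTop
      (𝓝 (Λ (⋃ i, A i) ω))

/-- The integral `∑ c, c * Λ {f = c}` of a simple function `f` with respect to `Λ`. The term with
`c = 0` vanishes, so only sets of finite measure matter if `f` vanishes outside such a set. -/
noncomputable def simpleStochInt {Ω : Type*} (Λ : Set ℝ → Ω → ℝ) (f : SimpleFunc ℝ ℝ) (ω : Ω) : ℝ :=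
  ∑ c ∈ f.range, c * Λ (f ⁻¹' {c}) ω

/-- `Y` is (a version of) the stochastic integral `∫ f dΛ` of `f ∈ L^α(ℝ)`: it is the limit in
probability of the integrals of simple functions, supported on sets of finite Lebesgue measure,
that converge to `f` in `L^α(ℝ)`. -/
def IsStochInt {Ω : Type*} [MeasurableSpace Ω] (α : ℝ) (P : Measure Ω)
    (Λ : Set ℝ → Ω → ℝ) (f : ℝ → ℝ) (Y : Ω → ℝ) : Prop :=
  ∃ g : ℕ → SimpleFunc ℝ ℝ, (∀ n, (g n).FinMeasSupp volume) ∧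
    Tendsto (fun n ↦ ∫⁻ x, ENNReal.ofReal (|g n x - f x| ^ α)) atTop (𝓝 0) ∧
    TendstoInMeasure P (fun n ↦ simpleStochInt Λ (g n)) atTop Y

/-- `X` is a symmetric `α`-stable moving average with kernel function `m`, that is,
`X t = ∫ m (t - x) Λ(dx)` for all `t`, where `Λ` is a symmetric `α`-stable random measure on `ℝ`
with Lebesgue control measure. -/
def IsSaSMovingAverage {Ω : Type*} [MeasurableSpace Ω] (α : ℝ) (P : Measure Ω) (m : ℝ → ℝ)
    (X : ℝ → Ω → ℝ) : Prop :=
  ∃ Λ : Set ℝ → Ω → ℝ, IsSaSRandomMeasure α P Λ ∧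
    ∀ t : ℝ, IsStochInt α P Λ (fun x ↦ m (t - x)) (X t)

/-- All finite-dimensional distributions of `X` are invariant under translations. -/
def IsStationaryProcess {Ω : Type*} [MeasurableSpace Ω] (P : Measure Ω) (X : ℝ → Ω → ℝ) : Prop :=
  ∀ (n : ℕ) (t : Fin n → ℝ) (h : ℝ),
    IdentDistrib (fun ω i ↦ X (t i + h) ω) (fun ω i ↦ X (t i) ω) P P

/-- The covariance `Cov (1 {X 0 > u}, 1 {X t > v})` of excursion indicators. -/
noncomputable def excursionCov {Ω : Type*} [MeasurableSpace Ω] (P : Measure Ω) (X : ℝ → Ω → ℝ)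
    (t u v : ℝ) : ℝ :=
  covariance ({ω | X 0 ω > u}.indicator fun _ ↦ (1 : ℝ))
    ({ω | X t ω > v}.indicator fun _ ↦ (1 : ℝ)) P

/-- The stationary process `X` (indexed by `ℝ`) is long range dependent: for some finite measure
`μ`, the integral of `|Cov (1 {X 0 > u}, 1 {X t > v})|` with respect to `μ(du) μ(dv) dt` is
infinite. -/
def IsLongRangeDependent {Ω : Type*} [MeasurableSpace Ω] (P : Measure Ω) (X : ℝ → Ω → ℝ) : Prop :=
  IsStationaryProcess P X ∧
    ∃ μ : Measure ℝ, IsFiniteMeasure μ ∧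
      ∫⁻ t, ∫⁻ v, ∫⁻ u, ENNReal.ofReal |excursionCov P X t u v| ∂μ ∂μ = ∞

/-- `∫_a^∞ t m(t)^α dt = ∞`, for a nonnegative function `m` and `a > 0`. -/
def RightMomentInfinite (α : ℝ) (m : ℝ → ℝ) (a : ℝ) : Prop :=
  ∫⁻ t in Ioi a, ENNReal.ofReal (t * m t ^ α) = ∞

/-- `∫_{-∞}^{-a} t m(t)^α dt = -∞`, for a nonnegative function `m` and `a > 0`. The integrand is
nonpositive, and its negative is integrated. -/
def LeftMomentInfinite (α : ℝ) (m : ℝ → ℝ) (a : ℝ) : Prop :=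
  ∫⁻ t in Iio (-a), ENNReal.ofReal (-(t * m t ^ α)) = ∞

/-! Take `μ` with density `|φ'|`, where `φ u = exp (-u ^ 2 / 2)`. Hoeffding's formula writes `Cov (φ
(X 0), φ (X t))` as the double integral of `φ' u * φ' v` against the excursion covariances, so the
inner double `μ`-integral dominates this covariance, although `φ'` changes sign.

On the other hand, `φ` is the characteristic function of the standard Gaussian law `γ`, so the same
covariance is the average over `γ ⊗ γ` of `Cov (cos (s X 0), cos (r X t))`. The characteristic
functions of a moving average, the convexity of `exp` and a strict form of `|x+y|^α + |x-y|^α ≤ 2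
(|x|^α + |y|^α)` (this is where `α < 2` matters) show that these covariances are nonnegative, and
for `s, r ∈ [1, 2]` at least a constant times the overlap `∫ min (m x) (m (t + x)) ^ α dx`.

It remains to see that the overlap has infinite integral over `t`. If `m` decreases on `(a, ∞)`, the
overlap at `t > 0` is at least `∫_{a+t}^∞ m^α`, and Tonelli turns the integral of these tails into
`∫_a^∞ (z - a) m(z)^α dz`, infinite because `∫ m^α` is finite. The increasing case follows by
reflection.

The carrying lemmas are `abs_add_rpow_add_abs_sub_rpow_le`, `IsSaSMovingAverage.le_covariance_cos`,
`integral_excursionCov` and `lintegral_kernelOverlap_eq_top`. -/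

/-! ### Finite additivity of the random measure and integrals of simple functions -/

section RandomMeasure

variable {Ω : Type*} [MeasurableSpace Ω] {P : Measure Ω} {α : ℝ}
  {Λ : Set ℝ → Ω → ℝ}

/-- For the constant sequence `∅` the partial sums converge, so their increments `Λ ∅` tend to zero.
-/
theorem IsSaSRandomMeasure.empty_ae (h : IsSaSRandomMeasure α P Λ) : ∀ᵐ ω ∂P, Λ ∅ ω = 0 := by
  have := h.sigma_additive (fun _ ↦ ∅) (fun _ ↦ MeasurableSet.empty) (fun _ _ _ ↦ disjoint_bot_left)
    (by simp)
  filter_upwards [this] with ω hω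
  have h1 := ((tendsto_add_atTop_iff_nat 1).2 hω).sub hω
  simp only [Finset.sum_range_succ, add_sub_cancel_left, sub_self] at h1
  exact tendsto_nhds_unique tendsto_const_nhds h1

theorem IsSaSRandomMeasure.union_ae (h : IsSaSRandomMeasure α P Λ) {A B : Set ℝ}
    (hA : MeasurableSet A) (hB : MeasurableSet B) (hAf : volume A < ∞) (hBf : volume B < ∞)
    (hAB : Disjoint A B) : ∀ᵐ ω ∂P, Λ (A ∪ B) ω = Λ A ω + Λ B ω := by
  let S : ℕ → Set ℝ := fun n ↦ if n = 0 then A else if n = 1 then B else ∅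
  have hU : ⋃ i, S i = A ∪ B := by
    ext x
    simp only [mem_iUnion, mem_union, S]
    constructor
    · rintro ⟨i, hi⟩
      split_ifs at hi <;> simp_all
    · rintro (hx | hx)
      · exact ⟨0, by simpa using hx⟩
      · exact ⟨1, by simpa using hx⟩
  have hS := h.sigma_additive S
    (by intro i; simp only [S]; split_ifs <;> simp [hA, hB])
    (by
      intro i j hij
      simp only [S]
      split_ifs <;> simp_all [disjoint_comm])
    (by rw [hU]; exact (measure_union_le A B).trans_lt (ENNReal.add_lt_top.2 ⟨hAf, hBf⟩))
  rw [hU] at hS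
  filter_upwards [hS, h.empty_ae] with ω hω h0
  refine tendsto_nhds_unique hω ?_
  refine tendsto_const_nhds.congr' ?_
  filter_upwards [eventually_ge_atTop 2] with n hn
  obtain ⟨k, rfl⟩ := Nat.exists_eq_add_of_le hn
  have : ∑ i ∈ Finset.range k, Λ (S (2 + i)) ω = 0 := by
    refine Finset.sum_eq_zero fun i _ ↦ ?_
    have : S (2 + i) = ∅ := by
      simp only [S]
      rw [if_neg (by omega), if_neg (by omega)]
    rw [this, h0]
  rw [Finset.sum_range_add, this, Finset.sum_range_succ, Finset.sum_range_one]
  simp [S]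

theorem IsSaSRandomMeasure.biUnion_ae (h : IsSaSRandomMeasure α P Λ) {ι : Type*}
    (s : Finset ι) (A : ι → Set ℝ) (hA : ∀ i ∈ s, MeasurableSet (A i))
    (hAf : ∀ i ∈ s, volume (A i) < ∞) (hd : (s : Set ι).PairwiseDisjoint A) :
    ∀ᵐ ω ∂P, Λ (⋃ i ∈ s, A i) ω = ∑ i ∈ s, Λ (A i) ω := by
  classical
  induction s using Finset.induction_on with
  | empty => simpa using h.empty_ae
  | insert i s hi ih =>
    have h1 := ih (fun j hj ↦ hA j (Finset.mem_insert_of_mem hj))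
      (fun j hj ↦ hAf j (Finset.mem_insert_of_mem hj))
      (hd.subset (by simp))
    have h2 := h.union_ae (A := A i) (B := ⋃ j ∈ s, A j) (hA i (by simp))
      (Finset.measurableSet_biUnion _ fun j hj ↦ hA j (Finset.mem_insert_of_mem hj))
      (hAf i (by simp))
      (measure_biUnion_lt_top s.finite_toSet
        fun j hj ↦ hAf j (Finset.mem_insert_of_mem hj))
      (by
        rw [disjoint_iUnion₂_right]
        intro j hj
        exact hd (by simp) (by simp [hj]) (by rintro rfl; exact hi hj))
    filter_upwards [h1, h2] with ω h1 h2
    rw [Finset.set_biUnion_insert, h2, h1, Finset.sum_insert hi]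

/-- Fibres of `F` with the same `g`-value merge by finite additivity. Applied to a pair of simple
functions, this gives a common partition and hence linearity of the integral. -/
theorem IsSaSRandomMeasure.simpleStochInt_map (h : IsSaSRandomMeasure α P Λ) {E : Type*} [Zero E]
    (F : SimpleFunc ℝ E) (hF : F.FinMeasSupp volume) (g : E → ℝ) (hg : g 0 = 0) :
    ∀ᵐ ω ∂P, simpleStochInt Λ (F.map g) ω = ∑ b ∈ F.range, g b * Λ (F ⁻¹' {b}) ω := by
  classical
  have key : ∀ c ∈ (F.map g).range, ∀ᵐ ω ∂P, c * Λ (F.map g ⁻¹' {c}) ω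
      = c * ∑ b ∈ F.range with g b = c, Λ (F ⁻¹' {b}) ω := by
    intro c _
    -- The fibre over `0` may have infinite measure, where nothing is known about `Λ`; the factor
    -- `c` removes it.
    by_cases hc : c = 0
    · simp [hc]
    · have hb : ∀ b ∈ F.range.filter (fun b ↦ g b = c), b ≠ 0 := by
        rintro b hb rfl
        rw [Finset.mem_filter, hg] at hb
        exact hc hb.2.symm
      have := h.biUnion_ae (F.range.filter fun b ↦ g b = c) (fun b ↦ F ⁻¹' {b})
        (fun b _ ↦ F.measurableSet_fiber b)
        (fun b hb' ↦ hF.meas_preimage_singleton_ne_zero (hb b hb'))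
        (fun b _ b' _ hbb ↦ (disjoint_singleton.2 hbb).preimage F)
      filter_upwards [this] with ω hω
      rw [← hω]
      congr 2
      rw [SimpleFunc.map_preimage_singleton]
      ext x
      simp
  filter_upwards [(ae_ball_iff (F.map g).range.countable_toSet).2 key] with ω hω
  rw [simpleStochInt, Finset.sum_congr rfl hω]
  rw [← Finset.sum_fiberwise_of_maps_to (s := F.range) (t := (F.map g).range) (g := g)]
  · refine Finset.sum_congr rfl fun c _ ↦ ?_
    rw [Finset.mul_sum]
    refine Finset.sum_congr rfl fun b hb ↦ ?_
    rw [(Finset.mem_filter.1 hb).2]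
  · intro b hb
    rw [SimpleFunc.range_map]
    exact Finset.mem_image_of_mem g hb

theorem IsSaSRandomMeasure.simpleStochInt_add (h : IsSaSRandomMeasure α P Λ)
    {f g : SimpleFunc ℝ ℝ} (hf : f.FinMeasSupp volume) (hg : g.FinMeasSupp volume) :
    ∀ᵐ ω ∂P, simpleStochInt Λ (f + g) ω = simpleStochInt Λ f ω + simpleStochInt Λ g ω := by
  have hF := hf.pair hg
  filter_upwards [h.simpleStochInt_map (f.pair g) hF (fun p ↦ p.1 + p.2) (by simp),
    h.simpleStochInt_map (f.pair g) hF Prod.fst rfl,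
    h.simpleStochInt_map (f.pair g) hF Prod.snd rfl] with ω h1 h2 h3
  have e1 : (f.pair g).map (fun p ↦ p.1 + p.2) = f + g := by ext; simp
  have e2 : (f.pair g).map Prod.fst = f := by ext; simp
  have e3 : (f.pair g).map Prod.snd = g := by ext; simp
  rw [e1] at h1
  rw [e2] at h2
  rw [e3] at h3
  rw [h1, h2, h3, ← Finset.sum_add_distrib]
  exact Finset.sum_congr rfl fun b _ ↦ add_mul _ _ _

theorem IsSaSRandomMeasure.simpleStochInt_const_mul (h : IsSaSRandomMeasure α P Λ)
    {f : SimpleFunc ℝ ℝ} (hf : f.FinMeasSupp volume) (c : ℝ) :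
    ∀ᵐ ω ∂P, simpleStochInt Λ (f.map (c * ·)) ω = c * simpleStochInt Λ f ω := by
  filter_upwards [h.simpleStochInt_map f hf (c * ·) (by simp)] with ω hω
  rw [hω, simpleStochInt, Finset.mul_sum]
  exact Finset.sum_congr rfl fun b _ ↦ mul_assoc _ _ _

theorem IsSaSRandomMeasure.measurable_simpleStochInt (h : IsSaSRandomMeasure α P Λ)
    {f : SimpleFunc ℝ ℝ} (hf : f.FinMeasSupp volume) : Measurable (simpleStochInt Λ f) := by
  unfold simpleStochInt
  refine Finset.measurable_fun_sum _ fun c _ ↦ ?_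
  by_cases hc : c = 0
  · simp [hc]
  · exact (h.measurable _ (f.measurableSet_fiber c)
      (hf.meas_preimage_singleton_ne_zero hc)).const_mul c

/-- Independence over the disjoint fibres turns the characteristic function into a product. The
argument `1` suffices, since scalars can be absorbed into `f`. -/
theorem IsSaSRandomMeasure.charFun_simpleStochInt (h : IsSaSRandomMeasure α P Λ) (hα : 0 < α)
    {f : SimpleFunc ℝ ℝ} (hf : f.FinMeasSupp volume) :
    charFun (P.map (simpleStochInt Λ f)) 1
      = ((Real.exp (-(∫⁻ x, ENNReal.ofReal (|f x| ^ α)).toReal) : ℝ) : ℂ) := by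
  classical
  set R := f.range.filter (· ≠ 0) with hR
  have hR0 : ∀ c ∈ R, c ≠ 0 := fun c hc ↦ (Finset.mem_filter.1 hc).2
  have hsum : ∀ (φ : ℝ → ℝ), φ 0 = 0 → ∑ c ∈ f.range, φ c = ∑ c ∈ R, φ c := by
    intro φ h0
    rw [hR, Finset.sum_filter]
    refine Finset.sum_congr rfl fun c _ ↦ ?_
    split_ifs with hc
    · rfl
    · rw [not_not.1 hc, h0]
  let e := R.equivFin
  have hfin : ∀ c : R, volume (f ⁻¹' {(c : ℝ)}) < ∞ := fun c ↦
    hf.meas_preimage_singleton_ne_zero (hR0 c c.2)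
  have hind : iIndepFun (fun i : Fin R.card ↦ Λ (f ⁻¹' {((e.symm i : R) : ℝ)})) P := by
    refine h.indep _ _ (fun i ↦ f.measurableSet_fiber _) (fun i ↦ hfin _) fun i j hij ↦ ?_
    refine (disjoint_singleton.2 fun hh ↦ hij ?_).preimage f
    exact e.symm.injective (Subtype.ext hh)
  have hind2 := hind.comp (fun i x ↦ ((e.symm i : R) : ℝ) * x) (fun i ↦ measurable_const_mul _)
  have hm : ∀ i : Fin R.card, AEMeasurable
      ((fun x ↦ ((e.symm i : R) : ℝ) * x) ∘ Λ (f ⁻¹' {((e.symm i : R) : ℝ)})) P := fun i ↦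
    ((h.measurable _ (f.measurableSet_fiber _) (hfin _)).const_mul _).aemeasurable
  have h1 := hind2.charFun_map_fun_sum_eq_prod hm
  have hsi : simpleStochInt Λ f = fun ω ↦ ∑ i : Fin R.card,
      ((fun x ↦ ((e.symm i : R) : ℝ) * x) ∘ Λ (f ⁻¹' {((e.symm i : R) : ℝ)})) ω := by
    funext ω
    rw [simpleStochInt, hsum (fun c ↦ c * Λ (f ⁻¹' {c}) ω) (by simp), ← Finset.sum_coe_sort]
    exact (e.symm.sum_comp (fun c : R ↦ (c : ℝ) * Λ (f ⁻¹' {(c : ℝ)}) ω)).symm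
  rw [hsi, h1, Finset.prod_apply]
  have hfac : ∀ i : Fin R.card, charFun (P.map
      ((fun x ↦ ((e.symm i : R) : ℝ) * x) ∘ Λ (f ⁻¹' {((e.symm i : R) : ℝ)}))) 1
      = ((Real.exp (-((volume (f ⁻¹' {((e.symm i : R) : ℝ)})).toReal
        * |((e.symm i : R) : ℝ)| ^ α)) : ℝ) : ℂ) := by
    intro i
    have hmi := h.measurable _ (f.measurableSet_fiber _) (hfin (e.symm i))
    rw [← Measure.map_map (measurable_const_mul _) hmi, charFun_map_mul, mul_one, h.charFun_eq _
      (f.measurableSet_fiber _) (hfin (e.symm i))]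
  rw [Finset.prod_congr rfl fun i _ ↦ hfac i, ← Complex.ofReal_prod, ← Real.exp_sum,
    Finset.sum_neg_distrib]
  congr 3
  rw [e.symm.sum_comp (fun c : R ↦ (volume (f ⁻¹' {(c : ℝ)})).toReal * |(c : ℝ)| ^ α),
    Finset.sum_coe_sort R (fun c ↦ (volume (f ⁻¹' {c})).toReal * |c| ^ α)]
  have h2 : (∫⁻ x, ENNReal.ofReal (|f x| ^ α))
      = ∑ c ∈ f.range, ENNReal.ofReal (|c| ^ α) * volume (f ⁻¹' {c}) := by
    rw [← SimpleFunc.map_lintegral, ← SimpleFunc.lintegral_eq_lintegral]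
    rfl
  rw [h2, ENNReal.toReal_sum, ← hsum (fun c ↦ (volume (f ⁻¹' {c})).toReal * |c| ^ α)]
  · refine Finset.sum_congr rfl fun c _ ↦ ?_
    rw [ENNReal.toReal_mul, ENNReal.toReal_ofReal (by positivity), mul_comm]
  · simp [hα.ne']
  · intro c _
    by_cases hc : c = 0
    · simp [hc, Real.zero_rpow hα.ne']
    · exact ENNReal.mul_ne_top ENNReal.ofReal_ne_top
        (hf.meas_preimage_singleton_ne_zero hc).ne

end RandomMeasure

/-! ### Continuity of the `α`-th power integral for every `α > 0` -/

section Quasinorm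

theorem lintegral_abs_rpow_const_mul {α : ℝ} (c : ℝ) (f : ℝ → ℝ) :
    ∫⁻ x, ENNReal.ofReal (|c * f x| ^ α)
      = ENNReal.ofReal (|c| ^ α) * ∫⁻ x, ENNReal.ofReal (|f x| ^ α) := by
  rw [← lintegral_const_mul' _ _ ENNReal.ofReal_ne_top]
  refine lintegral_congr fun x ↦ ?_
  rw [abs_mul, Real.mul_rpow (abs_nonneg _) (abs_nonneg _), ENNReal.ofReal_mul (by positivity)]

/-- One triangle inequality for both ranges of `α`: `q = 1` by subadditivity of the power if `α ≤
1`, and `q = 1 / α` by Minkowski if `α ≥ 1`. -/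
theorem exists_rpow_lintegral_abs_rpow_add_le {α : ℝ} (hα : 0 < α) :
    ∃ q : ℝ, 0 < q ∧ ∀ f g : ℝ → ℝ, AEMeasurable f → AEMeasurable g →
      (∫⁻ x, ENNReal.ofReal (|f x + g x| ^ α)) ^ q
        ≤ (∫⁻ x, ENNReal.ofReal (|f x| ^ α)) ^ q + (∫⁻ x, ENNReal.ofReal (|g x| ^ α)) ^ q := by
  rcases le_total α 1 with h1 | h1
  · refine ⟨1, one_pos, fun f g hf hg ↦ ?_⟩
    simp only [ENNReal.rpow_one]
    rw [← lintegral_add_left' (by fun_prop)]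
    refine lintegral_mono fun x ↦ ?_
    rw [← ENNReal.ofReal_add (by positivity) (by positivity)]
    refine ENNReal.ofReal_le_ofReal ?_
    exact (Real.rpow_le_rpow (abs_nonneg _) (abs_add_le _ _) hα.le).trans
      (Real.rpow_add_le_add_rpow (abs_nonneg _) (abs_nonneg _) hα.le h1)
  · refine ⟨1 / α, by positivity, fun f g hf hg ↦ ?_⟩
    have key := ENNReal.lintegral_Lp_add_le (μ := volume) (p := α)
      (f := fun x ↦ ENNReal.ofReal |f x|) (g := fun x ↦ ENNReal.ofReal |g x|)
      (by fun_prop) (by fun_prop) h1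
    simp only [Pi.add_apply] at key
    have e : ∀ h : ℝ → ℝ, ∫⁻ x, ENNReal.ofReal (|h x| ^ α)
        = ∫⁻ x, ENNReal.ofReal |h x| ^ α := fun h ↦ lintegral_congr fun x ↦
      (ENNReal.ofReal_rpow_of_nonneg (abs_nonneg _) hα.le).symm
    rw [e (fun x ↦ f x + g x), e f, e g]
    refine le_trans (ENNReal.rpow_le_rpow (lintegral_mono fun x ↦
      ENNReal.rpow_le_rpow ?_ hα.le) (by positivity)) key
    rw [← ENNReal.ofReal_add (by positivity) (by positivity)]
    exact ENNReal.ofReal_le_ofReal (abs_add_le _ _)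

theorem tendsto_lintegral_abs_rpow {α : ℝ} (hα : 0 < α) {g : ℕ → ℝ → ℝ} {f : ℝ → ℝ}
    (hg : ∀ n, AEMeasurable (g n)) (hf : AEMeasurable f)
    (hfin : ∫⁻ x, ENNReal.ofReal (|f x| ^ α) ≠ ∞)
    (h : Tendsto (fun n ↦ ∫⁻ x, ENNReal.ofReal (|g n x - f x| ^ α)) atTop (𝓝 0)) :
    Tendsto (fun n ↦ ∫⁻ x, ENNReal.ofReal (|g n x| ^ α)) atTop
      (𝓝 (∫⁻ x, ENNReal.ofReal (|f x| ^ α))) := by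
  obtain ⟨q, hq, hadd⟩ := exists_rpow_lintegral_abs_rpow_add_le hα
  have hd : Tendsto (fun n ↦ (∫⁻ x, ENNReal.ofReal (|g n x - f x| ^ α)) ^ q) atTop (𝓝 0) := by
    have := h.ennrpow_const q
    rwa [ENNReal.zero_rpow_of_pos hq] at this
  have hup : ∀ n, (∫⁻ x, ENNReal.ofReal (|g n x| ^ α)) ^ q
      ≤ (∫⁻ x, ENNReal.ofReal (|f x| ^ α)) ^ q
        + (∫⁻ x, ENNReal.ofReal (|g n x - f x| ^ α)) ^ q := by
    intro n
    simpa using hadd f (fun x ↦ g n x - f x) hf ((hg n).sub hf)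
  have hlo : ∀ n, (∫⁻ x, ENNReal.ofReal (|f x| ^ α)) ^ q
      - (∫⁻ x, ENNReal.ofReal (|g n x - f x| ^ α)) ^ q
        ≤ (∫⁻ x, ENNReal.ofReal (|g n x| ^ α)) ^ q := by
    intro n
    rw [tsub_le_iff_right]
    have := hadd (g n) (fun x ↦ f x - g n x) (hg n) (hf.sub (hg n))
    simpa [abs_sub_comm] using this
  have hfq : (∫⁻ x, ENNReal.ofReal (|f x| ^ α)) ^ q ≠ ∞ := ENNReal.rpow_ne_top_of_nonneg hq.le hfin
  have hlim : Tendsto (fun n ↦ (∫⁻ x, ENNReal.ofReal (|g n x| ^ α)) ^ q) atTop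
      (𝓝 ((∫⁻ x, ENNReal.ofReal (|f x| ^ α)) ^ q)) := by
    refine tendsto_of_tendsto_of_tendsto_of_le_of_le ?_ ?_ hlo hup
    · have := ENNReal.Tendsto.sub (tendsto_const_nhds (x := (∫⁻ x, ENNReal.ofReal (|f x| ^ α)) ^ q))
        hd (Or.inl hfq)
      simpa using this
    · simpa using tendsto_const_nhds.add hd
  have := hlim.ennrpow_const q⁻¹
  simpa [ENNReal.rpow_rpow_inv hq.ne'] using this

end Quasinorm

/-! ### Linearity and characteristic function of the stochastic integral -/

section StochInt

variable {Ω : Type*} [MeasurableSpace Ω] {P : Measure Ω} {α : ℝ} {Λ : Set ℝ → Ω → ℝ}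

theorem tendstoInMeasure_add {f f' : ℕ → Ω → ℝ} {g g' : Ω → ℝ}
    (h : TendstoInMeasure P f atTop g) (h' : TendstoInMeasure P f' atTop g') :
    TendstoInMeasure P (fun n ω ↦ f n ω + f' n ω) atTop (fun ω ↦ g ω + g' ω) := by
  rw [tendstoInMeasure_iff_norm] at h h' ⊢
  intro ε hε
  have := (h (ε / 2) (half_pos hε)).add (h' (ε / 2) (half_pos hε))
  rw [add_zero] at this
  refine tendsto_of_tendsto_of_tendsto_of_le_of_le tendsto_const_nhds this (fun _ ↦ zero_le)
    fun n ↦ (measure_mono fun ω hω ↦ ?_).trans (measure_union_le _ _)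
  simp only [mem_ofPred_eq, mem_union] at hω ⊢
  by_contra! hc
  have := norm_add_le (f n ω - g ω) (f' n ω - g' ω)
  rw [← add_sub_add_comm] at this
  linarith [hc.1, hc.2]

theorem tendstoInMeasure_const_mul {f : ℕ → Ω → ℝ} {g : Ω → ℝ} (c : ℝ)
    (h : TendstoInMeasure P f atTop g) :
    TendstoInMeasure P (fun n ω ↦ c * f n ω) atTop (fun ω ↦ c * g ω) := by
  rw [tendstoInMeasure_iff_norm] at h ⊢
  intro ε hε
  have hc : 0 < |c| + 1 := by positivity
  refine tendsto_of_tendsto_of_tendsto_of_le_of_le tendsto_const_nhds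
    (h (ε / (|c| + 1)) (by positivity)) (fun _ ↦ zero_le) fun n ↦ measure_mono fun ω hω ↦ ?_
  simp only [mem_ofPred_eq] at hω ⊢
  rw [div_le_iff₀ hc]
  rw [← mul_sub, norm_mul, Real.norm_eq_abs c] at hω
  nlinarith [norm_nonneg (f n ω - g ω)]

theorem IsStochInt.const_mul (h : IsSaSRandomMeasure α P Λ) {f : ℝ → ℝ} {Y : Ω → ℝ}
    (hY : IsStochInt α P Λ f Y) (c : ℝ) :
    IsStochInt α P Λ (fun x ↦ c * f x) (fun ω ↦ c * Y ω) := by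
  obtain ⟨g, hg, hlim, hmeas⟩ := hY
  refine ⟨fun n ↦ (g n).map (c * ·), fun n ↦ (hg n).map (by simp), ?_, ?_⟩
  · have e : ∀ n, ∫⁻ x, ENNReal.ofReal (|(g n).map (c * ·) x - c * f x| ^ α)
        = ENNReal.ofReal (|c| ^ α) * ∫⁻ x, ENNReal.ofReal (|g n x - f x| ^ α) := by
      intro n
      rw [← lintegral_abs_rpow_const_mul]
      simp only [SimpleFunc.map_apply, mul_sub]
    simp only [e]
    simpa using ENNReal.Tendsto.const_mul hlim (Or.inr ENNReal.ofReal_ne_top)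
  · refine (tendstoInMeasure_const_mul c hmeas).congr_left fun n ↦ ?_
    filter_upwards [h.simpleStochInt_const_mul (hg n) c] with ω hω using hω.symm

theorem IsStochInt.add (h : IsSaSRandomMeasure α P Λ) (hα : 0 < α) {f f' : ℝ → ℝ} {Y Y' : Ω → ℝ}
    (hf : AEMeasurable f) (hf' : AEMeasurable f')
    (hY : IsStochInt α P Λ f Y) (hY' : IsStochInt α P Λ f' Y') :
    IsStochInt α P Λ (fun x ↦ f x + f' x) (fun ω ↦ Y ω + Y' ω) := by
  obtain ⟨g, hg, hlim, hmeas⟩ := hY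
  obtain ⟨g', hg', hlim', hmeas'⟩ := hY'
  refine ⟨fun n ↦ g n + g' n, fun n ↦ (hg n).add (hg' n), ?_, ?_⟩
  · obtain ⟨q, hq, hadd⟩ := exists_rpow_lintegral_abs_rpow_add_le hα
    have hs := (hlim.ennrpow_const q).add (hlim'.ennrpow_const q)
    rw [ENNReal.zero_rpow_of_pos hq, add_zero] at hs
    have h0 : Tendsto (fun n ↦ (∫⁻ x, ENNReal.ofReal
        (|(g n + g' n) x - (f x + f' x)| ^ α)) ^ q) atTop (𝓝 0) := by
      refine tendsto_of_tendsto_of_tendsto_of_le_of_le tendsto_const_nhds hs (fun _ ↦ zero_le)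
        fun n ↦ ?_
      have := hadd (fun x ↦ g n x - f x) (fun x ↦ g' n x - f' x)
        ((g n).measurable.aemeasurable.sub hf) ((g' n).measurable.aemeasurable.sub hf')
      simpa only [SimpleFunc.coe_add, Pi.add_apply, add_sub_add_comm] using this
    have := h0.ennrpow_const q⁻¹
    simpa [ENNReal.rpow_rpow_inv hq.ne', hq] using this
  · refine (tendstoInMeasure_add hmeas hmeas').congr_left fun n ↦ ?_
    filter_upwards [h.simpleStochInt_add (hg n) (hg' n)] with ω hω using hω.symm

theorem IsStochInt.zero (hα : 0 < α) : IsStochInt α P Λ (fun _ ↦ 0) (fun _ ↦ 0) := by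
  have h0 : simpleStochInt Λ (0 : SimpleFunc ℝ ℝ) = fun _ ↦ 0 := by
    funext ω
    refine Finset.sum_eq_zero fun c hc ↦ ?_
    simp only [SimpleFunc.mem_range, SimpleFunc.coe_zero, mem_range, Pi.zero_apply,
      exists_const] at hc
    rw [← hc, zero_mul]
  refine ⟨fun _ ↦ 0, fun _ ↦ ?_, ?_, ?_⟩
  · rw [SimpleFunc.finMeasSupp_iff_support]
    simp
  · simp [Real.zero_rpow hα.ne']
  · simp only [h0]
    rw [tendstoInMeasure_iff_norm]
    intro ε hε
    simp [hε.not_ge]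

theorem IsStochInt.sum (h : IsSaSRandomMeasure α P Λ) (hα : 0 < α) {ι : Type*} (s : Finset ι)
    {f : ι → ℝ → ℝ} {Y : ι → Ω → ℝ} (hf : ∀ i, AEMeasurable (f i))
    (hY : ∀ i, IsStochInt α P Λ (f i) (Y i)) (c : ι → ℝ) :
    IsStochInt α P Λ (fun x ↦ ∑ i ∈ s, c i * f i x) (fun ω ↦ ∑ i ∈ s, c i * Y i ω) := by
  classical
  induction s using Finset.induction_on with
  | empty => simpa using IsStochInt.zero hα
  | insert i s hi ih =>
    simp only [Finset.sum_insert hi]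
    exact ((hY i).const_mul h (c i)).add h hα ((hf i).const_mul _)
      (Finset.aemeasurable_fun_sum _ fun j _ ↦ (hf j).const_mul _) ih

theorem IsStochInt.aemeasurable (h : IsSaSRandomMeasure α P Λ) {f : ℝ → ℝ} {Y : Ω → ℝ}
    (hY : IsStochInt α P Λ f Y) : AEMeasurable Y P := by
  obtain ⟨g, hg, -, hmeas⟩ := hY
  exact hmeas.aemeasurable fun n ↦ (h.measurable_simpleStochInt (hg n)).aemeasurable

/-- Pass to the limit in the formula for simple functions, using dominated convergence along an
almost surely convergent subsequence. -/
theorem IsStochInt.charFun_one [IsProbabilityMeasure P] (h : IsSaSRandomMeasure α P Λ)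
    (hα : 0 < α) {f : ℝ → ℝ} {Y : Ω → ℝ} (hf : AEMeasurable f)
    (hfin : ∫⁻ x, ENNReal.ofReal (|f x| ^ α) ≠ ∞) (hY : IsStochInt α P Λ f Y) :
    charFun (P.map Y) 1 = ((Real.exp (-(∫⁻ x, ENNReal.ofReal (|f x| ^ α)).toReal) : ℝ) : ℂ) := by
  have hYm := hY.aemeasurable h
  obtain ⟨g, hg, hlim, hmeas⟩ := hY
  obtain ⟨ns, hns, hae⟩ := hmeas.exists_seq_tendsto_ae
  have hZ : ∀ (Z : Ω → ℝ), AEMeasurable Z P →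
      charFun (P.map Z) 1 = ∫ ω, Complex.exp (Z ω * Complex.I) ∂P := by
    intro Z hZ
    rw [charFun_apply_real, integral_map hZ (by fun_prop)]
    simp
  have hm := fun n ↦ h.measurable_simpleStochInt (hg n)
  have h1 : Tendsto (fun k ↦ charFun (P.map (simpleStochInt Λ (g (ns k)))) 1) atTop
      (𝓝 (charFun (P.map Y) 1)) := by
    rw [hZ Y hYm]
    simp only [fun k ↦ hZ _ (hm (ns k)).aemeasurable]
    refine tendsto_integral_of_dominated_convergence (fun _ ↦ 1) (fun k ↦ ?_)
      (integrable_const _) (fun k ↦ ae_of_all _ fun ω ↦ ?_) ?_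
    · have := hm (ns k)
      exact Measurable.aestronglyMeasurable (by fun_prop)
    · rw [Complex.norm_exp_ofReal_mul_I]
    · filter_upwards [hae] with ω hω
      exact (Continuous.tendsto (f := fun y : ℝ ↦ Complex.exp (y * Complex.I))
        (by fun_prop) (Y ω)).comp hω
  refine tendsto_nhds_unique h1 ?_
  simp only [fun k ↦ h.charFun_simpleStochInt hα (hg (ns k))]
  have h2 := tendsto_lintegral_abs_rpow hα (fun n ↦ (g n).measurable.aemeasurable) hf hfin hlim
  have h3 := ((ENNReal.tendsto_toReal hfin).comp h2).comp hns.tendsto_atTop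
  exact (Complex.continuous_ofReal.tendsto _).comp
    ((Real.continuous_exp.tendsto _).comp h3.neg)

end StochInt

/-! ### Integrability of the kernel and its reflected translates -/

section Kernel

variable {α : ℝ} {m : ℝ → ℝ}

theorem MeasureTheory.MemLp.integrable_abs_rpow (hα : 0 < α) {f : ℝ → ℝ}
    (hf : MemLp f (ENNReal.ofReal α) volume) : Integrable fun x ↦ |f x| ^ α := by
  have := hf.integrable_norm_rpow (by simpa using hα) ENNReal.ofReal_ne_top
  simpa only [ENNReal.toReal_ofReal hα.le, Real.norm_eq_abs] using this

theorem MeasureTheory.MemLp.comp_const_sub {p : ℝ≥0∞} {f : ℝ → ℝ} (hf : MemLp f p volume)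
    (t : ℝ) : MemLp (fun x ↦ f (t - x)) p volume :=
  hf.comp_measurePreserving (Measure.measurePreserving_sub_left volume t)

end Kernel

/-! ### Finite-dimensional laws and stationarity -/

section MovingAverage

variable {Ω : Type*} [MeasurableSpace Ω] {P : Measure Ω} {α : ℝ} {m : ℝ → ℝ} {X : ℝ → Ω → ℝ}

theorem IsSaSMovingAverage.aemeasurable (hX : IsSaSMovingAverage α P m X) (t : ℝ) :
    AEMeasurable (X t) P := by
  obtain ⟨Λ, hΛ, hX⟩ := hX
  exact (hX t).aemeasurable hΛ

theorem IsSaSMovingAverage.charFun_sum [IsProbabilityMeasure P] (hX : IsSaSMovingAverage α P m X)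
    (hα : 0 < α) (hm : MemLp m (ENNReal.ofReal α) volume) {ι : Type*} (s : Finset ι)
    (c t : ι → ℝ) :
    charFun (P.map fun ω ↦ ∑ i ∈ s, c i * X (t i) ω) 1
      = ((Real.exp (-∫ x, |∑ i ∈ s, c i * m (t i - x)| ^ α) : ℝ) : ℂ) := by
  obtain ⟨Λ, hΛ, hX⟩ := hX
  have hmt : ∀ i, MemLp (fun x ↦ m (t i - x)) (ENNReal.ofReal α) volume := fun i ↦
    hm.comp_const_sub (t i)
  have hmt' : ∀ i, AEMeasurable fun x ↦ m (t i - x) := fun i ↦ (hmt i).aestronglyMeasurable.aemeasurable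
  have hsum : MemLp (fun x ↦ ∑ i ∈ s, c i * m (t i - x)) (ENNReal.ofReal α) volume :=
    memLp_finsetSum s fun i _ ↦ (hmt i).const_mul (c i)
  have hint := hsum.integrable_abs_rpow hα
  have hY := IsStochInt.sum hΛ hα s hmt' (fun i ↦ hX (t i)) c
  rw [hY.charFun_one hΛ hα hsum.aestronglyMeasurable.aemeasurable,
    integral_eq_lintegral_of_nonneg_ae (ae_of_all _ fun x ↦ by positivity) hint.1]
  rw [← ofReal_integral_eq_lintegral_ofReal hint (ae_of_all _ fun x ↦ by positivity)]
  exact ENNReal.ofReal_ne_top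

/-- The law of a vector is determined by its linear functionals, whose characteristic functions are
explicit Lebesgue integrals; a time shift becomes a translation of `x`. -/
theorem IsSaSMovingAverage.isStationaryProcess [IsProbabilityMeasure P]
    (hX : IsSaSMovingAverage α P m X) (hα : 0 < α) (hm : MemLp m (ENNReal.ofReal α) volume) :
    IsStationaryProcess P X := by
  intro n t h
  have hv : ∀ t : Fin n → ℝ, AEMeasurable (fun ω i ↦ X (t i) ω) P := fun t ↦
    aemeasurable_pi_lambda _ fun i ↦ hX.aemeasurable (t i)
  refine ⟨hv fun i ↦ t i + h, hv t, ?_⟩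
  have hp : ∀ t : Fin n → ℝ, IsProbabilityMeasure (P.map fun ω i ↦ X (t i) ω) := fun t ↦
    Measure.isProbabilityMeasure_map (hv t)
  have := hp t
  have := hp fun i ↦ t i + h
  refine Measure.ext_of_charFunDual (funext fun L ↦ ?_)
  have key : ∀ t : Fin n → ℝ, charFunDual (P.map fun ω i ↦ X (t i) ω) L
      = ((Real.exp (-∫ x, |∑ i, L (Pi.single i 1) * m (t i - x)| ^ α) : ℝ) : ℂ) := by
    intro t
    rw [charFunDual_eq_charFun_map_one,
      AEMeasurable.map_map_of_aemeasurable L.continuous.measurable.aemeasurable (hv t),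
      ← hX.charFun_sum hα hm]
    congr 2
    funext ω
    have : (fun i ↦ X (t i) ω) = ∑ i, X (t i) ω • (Pi.single i (1 : ℝ) : Fin n → ℝ) := by
      funext j
      simp [Finset.sum_apply, Pi.single_apply]
    rw [Function.comp_apply, this, map_sum]
    exact Finset.sum_congr rfl fun i _ ↦ by rw [map_smul, smul_eq_mul, mul_comm]
  rw [key, key]
  congr 3
  rw [← integral_add_right_eq_self (fun x ↦ |∑ i, L (Pi.single i 1) * m (t i + h - x)| ^ α) h]
  simp only [add_sub_add_right_eq_sub]

theorem integral_cos_eq_re_charFun [IsProbabilityMeasure P] {Z : Ω → ℝ} (hZ : AEMeasurable Z P) :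
    ∫ ω, Real.cos (Z ω) ∂P = (charFun (P.map Z) 1).re := by
  rw [charFun_apply_real, integral_map hZ (by fun_prop), ← RCLike.re_eq_complex_re,
    ← integral_re]
  · refine integral_congr_ae (ae_of_all _ fun ω ↦ ?_)
    simp [Complex.exp_ofReal_mul_I_re]
  · refine Integrable.of_bound (C := 1) ?_ (ae_of_all _ fun ω ↦ ?_)
    · exact (Measurable.comp_aemeasurable (g := fun y : ℝ ↦ Complex.exp ((1 : ℝ) * y * Complex.I))
        (by fun_prop) hZ).aestronglyMeasurable
    · rw [← Complex.ofReal_mul, Complex.norm_exp_ofReal_mul_I]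

theorem IsSaSMovingAverage.integral_cos_add [IsProbabilityMeasure P]
    (hX : IsSaSMovingAverage α P m X)
    (hα : 0 < α) (hm : MemLp m (ENNReal.ofReal α) volume) (s r t : ℝ) :
    ∫ ω, Real.cos (s * X 0 ω + r * X t ω) ∂P
      = Real.exp (-∫ x, |s * m (-x) + r * m (t - x)| ^ α) := by
  have h := hX.charFun_sum hα hm Finset.univ ![s, r] ![0, t]
  simp only [Fin.sum_univ_two, Matrix.cons_val_zero, Matrix.cons_val_one, zero_sub] at h
  rw [integral_cos_eq_re_charFun (Z := fun ω ↦ s * X 0 ω + r * X t ω)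
    (((hX.aemeasurable 0).const_mul s).add ((hX.aemeasurable t).const_mul r)), h,
    Complex.ofReal_re]

theorem IsSaSMovingAverage.integral_cos [IsProbabilityMeasure P] (hX : IsSaSMovingAverage α P m X)
    (hα : 0 < α) (hm : MemLp m (ENNReal.ofReal α) volume) (s t : ℝ) :
    ∫ ω, Real.cos (s * X t ω) ∂P = Real.exp (-(|s| ^ α * ∫ x, |m x| ^ α)) := by
  have h := hX.integral_cos_add hα hm 0 s t
  simp only [zero_mul, zero_add] at h
  rw [h, integral_sub_left_eq_self (fun x ↦ |s * m x| ^ α) volume t, ← integral_const_mul]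
  congr 3
  funext x
  rw [abs_mul, Real.mul_rpow (abs_nonneg _) (abs_nonneg _)]

end MovingAverage

/-! ### A strict concavity estimate for powers -/

section PowerInequality

/-- For `v > 0`, the points `u` and `2v` are convex combinations of `v` and `u + v` with
complementary weights. Adding the two concavity inequalities gives `v^p + (u+v)^p ≤ u^p + (2v)^p`.
-/
theorem add_rpow_le_of_le {p u v : ℝ} (hp0 : 0 ≤ p) (hp1 : p ≤ 1) (hv : 0 ≤ v) (huv : v ≤ u) :
    (u + v) ^ p + (2 - 2 ^ p) * v ^ p ≤ u ^ p + v ^ p := by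
  rcases hv.eq_or_lt with rfl | hv
  · rcases hp0.eq_or_lt with rfl | hp0
    · simp
      norm_num
    · simp [Real.zero_rpow hp0.ne']
  have hu : 0 < u := hv.trans_le huv
  have hc := Real.concaveOn_rpow hp0 hp1
  have hvm : v ∈ Ici (0 : ℝ) := hv.le
  have huvm : u + v ∈ Ici (0 : ℝ) := add_nonneg hu.le hv.le
  have hw : 0 ≤ v / u := by positivity
  have hw' : 0 ≤ (u - v) / u := div_nonneg (by linarith) hu.le
  have h1 := hc.2 hvm huvm hw hw'
    (by field_simp; ring)
  have h2 := hc.2 hvm huvm hw' hw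
    (by field_simp; ring)
  simp only [smul_eq_mul] at h1 h2
  have e1 : v / u * v + (u - v) / u * (u + v) = u := by field_simp; ring
  have e2 : (u - v) / u * v + v / u * (u + v) = 2 * v := by field_simp; ring
  rw [e1] at h1
  rw [e2, Real.mul_rpow (by norm_num) hv.le] at h2
  have e3 : (u - v) / u = 1 - v / u := by field_simp
  rw [e3] at h1 h2
  linarith

/-- Write `|z|^α = (z^2)^(α/2)`. The mean of `(x+y)^2` and `(x-y)^2` is `x^2 + y^2`, so concavity
bounds the average by `(x^2+y^2)^(α/2)`, and `add_rpow_le_of_le` supplies the gain. -/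
theorem abs_add_rpow_add_abs_sub_rpow_le {α : ℝ} (hα0 : 0 < α) (hα2 : α < 2) (x y : ℝ) :
    (|x + y| ^ α + |x - y| ^ α) / 2 + (2 - 2 ^ (α / 2)) * (min |x| |y|) ^ α
      ≤ |x| ^ α + |y| ^ α := by
  have hsq : ∀ z : ℝ, |z| ^ α = (z ^ 2) ^ (α / 2) := by
    intro z
    rw [← sq_abs, ← Real.rpow_natCast, ← Real.rpow_mul (abs_nonneg z)]
    congr 1
    push_cast
    ring
  have hmin : (min |x| |y|) ^ α = (min (x ^ 2) (y ^ 2)) ^ (α / 2) := by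
    rw [← abs_of_nonneg (le_min (abs_nonneg x) (abs_nonneg y)), hsq]
    congr 1
    rcases le_total |x| |y| with h | h
    · rw [min_eq_left h, min_eq_left (sq_le_sq.2 h), sq_abs]
    · rw [min_eq_right h, min_eq_right (sq_le_sq.2 h), sq_abs]
  have hc := (Real.concaveOn_rpow (p := α / 2) (by linarith) (by linarith)).2
    (mem_Ici.2 (sq_nonneg (x + y))) (mem_Ici.2 (sq_nonneg (x - y)))
    (one_half_pos (α := ℝ)).le (one_half_pos (α := ℝ)).le (by norm_num)
  simp only [smul_eq_mul] at hc
  have e : 1 / 2 * (x + y) ^ 2 + 1 / 2 * (x - y) ^ 2 = x ^ 2 + y ^ 2 := by ring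
  rw [e] at hc
  rw [hmin, hsq, hsq, hsq, hsq]
  rcases le_total (x ^ 2) (y ^ 2) with h | h
  · rw [min_eq_left h]
    have := add_rpow_le_of_le (p := α / 2) (by linarith) (by linarith) (sq_nonneg x) h
    rw [add_comm (y ^ 2)] at this
    linarith
  · rw [min_eq_right h]
    have := add_rpow_le_of_le (p := α / 2) (by linarith) (by linarith) (sq_nonneg y) h
    linarith

end PowerInequality

/-! ### Interchanging covariance and parameter integrals -/

section Covariance

variable {Ω : Type*} [MeasurableSpace Ω] {P : Measure Ω} [IsProbabilityMeasure P]

theorem covariance_eq_integral_mul_sub {W Z : Ω → ℝ} {C D : ℝ}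
    (hW : AEStronglyMeasurable W P) (hWb : ∀ ω, |W ω| ≤ C)
    (hZ : AEStronglyMeasurable Z P) (hZb : ∀ ω, |Z ω| ≤ D) :
    cov[W, Z; P] = ∫ ω, W ω * (Z ω - P[Z]) ∂P := by
  have hZi : Integrable Z P := Integrable.of_bound hZ D (ae_of_all _ hZb)
  have hZ' : Integrable (fun ω ↦ Z ω - P[Z]) P := hZi.sub (integrable_const _)
  have hWZ : Integrable (fun ω ↦ W ω * (Z ω - P[Z])) P :=
    hZ'.bdd_mul hW (ae_of_all _ hWb)
  rw [covariance]
  simp only [sub_mul]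
  rw [integral_sub hWZ (hZ'.const_mul _), integral_const_mul, integral_sub hZi (integrable_const _)]
  simp

/-- Fubini, after centring only `Z`. It serves twice: with cosines under `γ`, and with indicators
weighted by `φ'` under Lebesgue measure. -/
theorem integral_covariance_comp {S : Type*} [MeasurableSpace S] {ρ : Measure S} [SFinite ρ]
    {K : S → ℝ → ℝ} (hK : Measurable (Function.uncurry K)) {g : S → ℝ} (hg : Integrable g ρ)
    (hKg : ∀ u x, |K u x| ≤ g u) {X Z : Ω → ℝ} (hX : AEMeasurable X P)
    {D : ℝ} (hZ : AEStronglyMeasurable Z P) (hZb : ∀ ω, |Z ω| ≤ D) :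
    Integrable (fun u ↦ cov[fun ω ↦ K u (X ω), Z; P]) ρ ∧
      ∫ u, cov[fun ω ↦ K u (X ω), Z; P] ∂ρ = cov[fun ω ↦ ∫ u, K u (X ω) ∂ρ, Z; P] := by
  have hZi : Integrable Z P := Integrable.of_bound hZ D (ae_of_all _ hZb)
  have hpair : AEMeasurable (fun p : S × Ω ↦ (p.1, X p.2)) (ρ.prod P) :=
    measurable_fst.aemeasurable.prodMk (hX.comp_snd)
  have hKm : AEMeasurable (fun p : S × Ω ↦ K p.1 (X p.2)) (ρ.prod P) :=
    hK.comp_aemeasurable hpair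
  have hI : Integrable (fun p : S × Ω ↦ K p.1 (X p.2) * (Z p.2 - P[Z])) (ρ.prod P) := by
    have h1 : Integrable (fun p : S × Ω ↦ g p.1 * (|D| + |P[Z]|)) (ρ.prod P) :=
      (hg.comp_fst P).mul_const _
    refine h1.mono' (hKm.aestronglyMeasurable.mul
      ((hZ.comp_snd).sub aestronglyMeasurable_const)) (ae_of_all _ fun p ↦ ?_)
    rw [norm_mul, Real.norm_eq_abs, Real.norm_eq_abs]
    refine mul_le_mul (hKg _ _) ?_ (abs_nonneg _) ((abs_nonneg _).trans (hKg p.1 0))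
    exact (abs_sub _ _).trans (add_le_add_left ((hZb _).trans (le_abs_self D)) _)
  have hcov : ∀ u, cov[fun ω ↦ K u (X ω), Z; P] = ∫ ω, K u (X ω) * (Z ω - P[Z]) ∂P := fun u ↦
    covariance_eq_integral_mul_sub
      ((hK.comp measurable_prodMk_left).comp_aemeasurable hX).aestronglyMeasurable
      (fun ω ↦ hKg u (X ω)) hZ hZb
  simp only [hcov]
  refine ⟨hI.integral_prod_left, ?_⟩
  rw [integral_integral_swap hI, covariance_eq_integral_mul_sub (C := ∫ u, g u ∂ρ) _ _ hZ hZb]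
  · simp only [integral_mul_const]
  · have hF : StronglyMeasurable fun x ↦ ∫ u, K u x ∂ρ :=
      StronglyMeasurable.integral_prod_left' (μ := ρ) (f := Function.uncurry K)
        hK.stronglyMeasurable
    exact (hF.measurable.comp_aemeasurable hX).aestronglyMeasurable
  · intro ω
    exact norm_integral_le_of_norm_le (f := fun u ↦ K u (X ω)) hg
      (ae_of_all _ fun u ↦ hKg u (X ω))

end Covariance

/-! ### Two integral representations of `exp (-x ^ 2 / 2)` -/

section Gaussian

theorem integral_cos_mul_gaussianReal (x : ℝ) :
    ∫ s, Real.cos (s * x) ∂(gaussianReal 0 1) = Real.exp (-x ^ 2 / 2) := by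
  have h := integral_cos_eq_re_charFun (P := gaussianReal 0 1) (Z := fun s ↦ x * s) (by fun_prop)
  rw [charFun_map_mul, mul_one, charFun_gaussianReal] at h
  simp only [mul_comm _ x, h]
  rw [← Complex.ofReal_re (Real.exp (-x ^ 2 / 2))]
  congr 1
  push_cast
  congr 1
  simp
  ring

theorem integrable_mul_exp_neg_sq_half : Integrable fun u : ℝ ↦ -u * Real.exp (-u ^ 2 / 2) := by
  have := (integrable_mul_exp_neg_mul_sq (b := 1 / 2) (by norm_num)).neg
  refine this.congr (ae_of_all _ fun u ↦ ?_)
  simp only [Pi.neg_apply, neg_mul]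
  congr 3
  ring

theorem integral_indicator_mul_exp_neg_sq_half (x : ℝ) :
    ∫ u : ℝ, (-u * Real.exp (-u ^ 2 / 2)) * (if u < x then 1 else 0) = Real.exp (-x ^ 2 / 2) := by
  have h1 : (fun u : ℝ ↦ (-u * Real.exp (-u ^ 2 / 2)) * (if u < x then 1 else 0))
      = (Iio x).indicator fun u : ℝ ↦ -u * Real.exp (-u ^ 2 / 2) := by
    funext u
    by_cases hu : u < x <;> simp [hu]
  rw [h1, integral_indicator measurableSet_Iio, ← integral_Iic_eq_integral_Iio,
    integral_Iic_of_hasDerivAt_of_tendsto' (f := fun u ↦ Real.exp (-u ^ 2 / 2)) (m := 0)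
      ?_ integrable_mul_exp_neg_sq_half.integrableOn ?_, sub_zero]
  · intro u _
    have : HasDerivAt (fun u : ℝ ↦ -u ^ 2 / 2) (-u) u := by
      have := ((hasDerivAt_pow 2 u).neg).div_const 2
      refine this.congr_deriv ?_
      simp only [Nat.cast_ofNat, Nat.add_one_sub_one, pow_one]
      ring
    simpa [mul_comm] using this.exp
  · refine Real.tendsto_exp_atBot.comp ?_
    have h2 : Tendsto (fun u : ℝ ↦ u ^ 2) atBot atTop := by
      have := (tendsto_pow_atTop (α := ℝ) two_ne_zero).comp tendsto_neg_atBot_atTop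
      simpa [Function.comp_def] using this
    have := (tendsto_neg_atTop_atBot.comp h2).atBot_div_const (r := 2) (by norm_num)
    simpa [Function.comp_def] using this

end Gaussian

/-! ### Lower bounds for covariances by kernel overlap -/

section CosineCovariance

variable {Ω : Type*} [MeasurableSpace Ω] {P : Measure Ω} [IsProbabilityMeasure P] {α : ℝ}
  {m : ℝ → ℝ} {X : ℝ → Ω → ℝ}

theorem integrable_min_abs_rpow (hα : 0 < α) {f g : ℝ → ℝ}
    (hf : MemLp f (ENNReal.ofReal α) volume) (hg : AEMeasurable g) :
    Integrable fun x ↦ (min |f x| |g x|) ^ α := by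
  have hfm := hf.aestronglyMeasurable.aemeasurable
  refine (hf.integrable_abs_rpow hα).mono'
    ((measurable_norm.comp_aemeasurable hfm).min
      (measurable_norm.comp_aemeasurable hg) |>.pow_const α).aestronglyMeasurable (ae_of_all _ fun x ↦ ?_)
  have h0 : 0 ≤ min |f x| |g x| := le_min (abs_nonneg _) (abs_nonneg _)
  rw [Real.norm_of_nonneg (by positivity)]
  exact Real.rpow_le_rpow h0 (min_le_left _ _) hα.le

/-- The covariance of cosines of two values of a symmetric stable moving average is bounded below
by the overlap of the two kernels. -/
theorem IsSaSMovingAverage.le_covariance_cos (hX : IsSaSMovingAverage α P m X)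
    (hα0 : 0 < α) (hα2 : α < 2) (hm : MemLp m (ENNReal.ofReal α) volume) (s r t : ℝ) :
    Real.exp (-((|s| ^ α + |r| ^ α) * ∫ x, |m x| ^ α)) * ((2 - 2 ^ (α / 2)) *
        ∫ x, (min |s * m (-x)| |r * m (t - x)|) ^ α)
      ≤ cov[fun ω ↦ Real.cos (s * X 0 ω), fun ω ↦ Real.cos (r * X t ω); P] := by
  have hX0 := hX.aemeasurable 0
  have hXt := hX.aemeasurable t
  have hcos : ∀ {Z : Ω → ℝ}, AEMeasurable Z P → MemLp (fun ω ↦ Real.cos (Z ω)) 2 P := fun hZ ↦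
    MemLp.of_bound (Real.measurable_cos.comp_aemeasurable hZ).aestronglyMeasurable 1
      (ae_of_all _ fun ω ↦ Real.abs_cos_le_one _)
  rw [covariance_eq_sub (hcos (hX0.const_mul s)) (hcos (hXt.const_mul r)),
    hX.integral_cos hα0 hm, hX.integral_cos hα0 hm]
  set M := ∫ x, |m x| ^ α with hM
  set δ := ∫ x, (min |s * m (-x)| |r * m (t - x)|) ^ α with hδ
  set p := ∫ x, |s * m (-x) + r * m (t - x)| ^ α with hp
  set q := ∫ x, |s * m (-x) - r * m (t - x)| ^ α with hq
  -- Product-to-sum: `cos A * cos B` is the mean of `cos (A + B)` and `cos (A - B)`.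
  have hprod : ∫ ω, ((fun ω ↦ Real.cos (s * X 0 ω)) * fun ω ↦ Real.cos (r * X t ω)) ω ∂P
      = (Real.exp (-p) + Real.exp (-q)) / 2 := by
    have h2 := hX.integral_cos_add hα0 hm s (-r) t
    simp only [neg_mul, ← sub_eq_add_neg] at h2
    rw [← hX.integral_cos_add hα0 hm, ← h2, ← integral_add, ← integral_div]
    · refine integral_congr_ae (ae_of_all _ fun ω ↦ ?_)
      simp only [Pi.mul_apply, Real.cos_add, Real.cos_sub]
      ring
    · exact (hcos ((hX0.const_mul s).add (hXt.const_mul r))).integrable one_le_two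
    · exact (hcos ((hX0.const_mul s).sub (hXt.const_mul r))).integrable one_le_two
  rw [hprod]
  have hs : MemLp (fun x ↦ s * m (-x)) (ENNReal.ofReal α) volume := by
    simpa using (hm.comp_const_sub 0).const_mul s
  have hr : MemLp (fun x ↦ r * m (t - x)) (ENNReal.ofReal α) volume :=
    (hm.comp_const_sub t).const_mul r
  have hpi := (hs.add hr).integrable_abs_rpow hα0
  have hqi := (hs.sub hr).integrable_abs_rpow hα0
  simp only [Pi.add_apply, Pi.sub_apply] at hpi hqi
  have hδi := integrable_min_abs_rpow hα0 hs hr.aestronglyMeasurable.aemeasurable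
  have hint := integral_mono (((hpi.add hqi).div_const 2).add (hδi.const_mul (2 - 2 ^ (α / 2))))
    ((hs.integrable_abs_rpow hα0).add (hr.integrable_abs_rpow hα0))
    (fun x ↦ abs_add_rpow_add_abs_sub_rpow_le hα0 hα2 (s * m (-x)) (r * m (t - x)))
  rw [integral_add' ((hpi.add hqi).div_const 2) (hδi.const_mul _), integral_div,
    integral_add' hpi hqi, integral_const_mul,
    integral_add' (hs.integrable_abs_rpow hα0) (hr.integrable_abs_rpow hα0)] at hint
  have hsM : ∫ x, |s * m (-x)| ^ α = |s| ^ α * M := by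
    rw [integral_neg_eq_self (fun x ↦ |s * m x| ^ α), ← integral_const_mul]
    exact integral_congr_ae (ae_of_all _ fun x ↦ by
      simp only [abs_mul, Real.mul_rpow (abs_nonneg _) (abs_nonneg _)])
  have hrM : ∫ x, |r * m (t - x)| ^ α = |r| ^ α * M := by
    rw [integral_sub_left_eq_self (fun x ↦ |r * m x| ^ α), ← integral_const_mul]
    exact integral_congr_ae (ae_of_all _ fun x ↦ by
      simp only [abs_mul, Real.mul_rpow (abs_nonneg _) (abs_nonneg _)])
  rw [hsM, hrM] at hint
  -- Convexity of `exp` at the midpoint, as the arithmetic-geometric mean inequality.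
  have hconv : Real.exp (-((p + q) / 2)) ≤ (Real.exp (-p) + Real.exp (-q)) / 2 := by
    have e1 : Real.exp (-((p + q) / 2)) = Real.exp (-p / 2) * Real.exp (-q / 2) := by
      rw [← Real.exp_add]; congr 1; ring
    have e2 : ∀ z : ℝ, Real.exp (-z) = Real.exp (-z / 2) ^ 2 := fun z ↦ by
      rw [← Real.exp_nat_mul]; congr 1; push_cast; ring
    rw [e1, e2 p, e2 q]
    linarith [two_mul_le_add_sq (Real.exp (-p / 2)) (Real.exp (-q / 2))]
  -- The gain `(2 - 2 ^ (α / 2)) * δ` in the exponent becomes additive through `1 + z ≤ exp z`.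
  have hmono : Real.exp (-((|s| ^ α + |r| ^ α) * M)) * (1 + (2 - 2 ^ (α / 2)) * δ)
      ≤ Real.exp (-((p + q) / 2)) := by
    refine (mul_le_mul_of_nonneg_left ?_ (Real.exp_pos _).le).trans
      (b := Real.exp (-((|s| ^ α + |r| ^ α) * M)) * Real.exp ((2 - 2 ^ (α / 2)) * δ)) ?_
    · linarith [Real.add_one_le_exp ((2 - 2 ^ (α / 2)) * δ)]
    · rw [← Real.exp_add]
      refine Real.exp_le_exp.2 ?_
      linarith
  have hfac : Real.exp (-((|s| ^ α + |r| ^ α) * M))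
      = Real.exp (-(|s| ^ α * M)) * Real.exp (-(|r| ^ α * M)) := by
    rw [← Real.exp_add]; congr 1; ring
  rw [← hfac]
  linarith

theorem two_sub_two_rpow_pos (hα2 : α < 2) : 0 < (2 : ℝ) - 2 ^ (α / 2) := by
  have : (2 : ℝ) ^ (α / 2) < 2 ^ (1 : ℝ) :=
    Real.rpow_lt_rpow_of_exponent_lt one_lt_two (by linarith)
  rw [Real.rpow_one] at this
  linarith

/-- The window `[1, 2]` makes the bound uniform: `s, r ≥ 1` does not shrink the overlap, and `s, r ≤
2` bounds the exponential factor below. Off the window only nonnegativity is kept. -/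
theorem IsSaSMovingAverage.exists_le_covariance_cos (hX : IsSaSMovingAverage α P m X)
    (hα0 : 0 < α) (hα2 : α < 2) (hm : MemLp m (ENNReal.ofReal α) volume) (hm0 : ∀ x, 0 ≤ m x) :
    ∃ κ : ℝ, 0 < κ ∧ ∀ s r t : ℝ,
      (Icc 1 2).indicator (fun _ ↦ (1 : ℝ)) s * (Icc 1 2).indicator (fun _ ↦ (1 : ℝ)) r
          * (κ * ∫ x, (min (m (-x)) (m (t - x))) ^ α)
        ≤ cov[fun ω ↦ Real.cos (s * X 0 ω), fun ω ↦ Real.cos (r * X t ω); P] := by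
  have hc := two_sub_two_rpow_pos hα2
  have hM : 0 ≤ ∫ x, |m x| ^ α := integral_nonneg fun x ↦ by positivity
  refine ⟨Real.exp (-((2 ^ α + 2 ^ α) * ∫ x, |m x| ^ α)) * (2 - 2 ^ (α / 2)), by positivity,
    fun s r t ↦ le_trans ?_ (hX.le_covariance_cos hα0 hα2 hm s r t)⟩
  have hmin0 : ∀ a b : ℝ, 0 ≤ (min |a| |b|) ^ α := fun a b ↦
    Real.rpow_nonneg (le_min (abs_nonneg _) (abs_nonneg _)) _
  have hδ0 : 0 ≤ ∫ x, (min |s * m (-x)| |r * m (t - x)|) ^ α := integral_nonneg fun x ↦ hmin0 _ _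
  by_cases hsr : s ∈ Icc (1 : ℝ) 2 ∧ r ∈ Icc (1 : ℝ) 2
  · obtain ⟨hs, hr⟩ := hsr
    have hs' : |s| = s := abs_of_nonneg (by linarith [hs.1])
    have hr' : |r| = r := abs_of_nonneg (by linarith [hr.1])
    rw [indicator_of_mem hs, indicator_of_mem hr, one_mul, one_mul, mul_assoc]
    have hJ : ∫ x, (min (m (-x)) (m (t - x))) ^ α
        ≤ ∫ x, (min |s * m (-x)| |r * m (t - x)|) ^ α := by
      have hm1 : MemLp (fun x ↦ m (-x)) (ENNReal.ofReal α) volume := by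
        simpa using hm.comp_const_sub 0
      have hm2 := hm.comp_const_sub t
      refine integral_mono_of_nonneg
        (ae_of_all _ fun x ↦ Real.rpow_nonneg (le_min (hm0 _) (hm0 _)) _)
        (integrable_min_abs_rpow hα0 (hm1.const_mul s)
          (hm2.const_mul r).aestronglyMeasurable.aemeasurable) (ae_of_all _ fun x ↦ ?_)
      refine Real.rpow_le_rpow (le_min (hm0 _) (hm0 _)) (min_le_min ?_ ?_) hα0.le
      · rw [abs_mul, hs', abs_of_nonneg (hm0 _)]
        exact le_mul_of_one_le_left (hm0 _) hs.1
      · rw [abs_mul, hr', abs_of_nonneg (hm0 _)]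
        exact le_mul_of_one_le_left (hm0 _) hr.1
    refine mul_le_mul (Real.exp_le_exp.2 (neg_le_neg ?_)) (mul_le_mul_of_nonneg_left hJ hc.le)
      (mul_nonneg hc.le (integral_nonneg fun x ↦ Real.rpow_nonneg (le_min (hm0 _) (hm0 _)) _))
      (Real.exp_pos _).le
    rw [hs', hr']
    refine mul_le_mul_of_nonneg_right (add_le_add ?_ ?_) hM
    · exact Real.rpow_le_rpow (by linarith [hs.1]) hs.2 hα0.le
    · exact Real.rpow_le_rpow (by linarith [hr.1]) hr.2 hα0.le
  · have : (Icc 1 2).indicator (fun _ ↦ (1 : ℝ)) s * (Icc 1 2).indicator (fun _ ↦ (1 : ℝ)) r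
        = 0 := by
      rw [not_and_or] at hsr
      rcases hsr with h | h
      · rw [indicator_of_notMem h, zero_mul]
      · rw [indicator_of_notMem h, mul_zero]
    rw [this, zero_mul]
    positivity

/-- Average the cosine bound over independent Gaussian `s` and `r`; the window has positive Gaussian
mass. -/
theorem IsSaSMovingAverage.exists_le_covariance_exp (hX : IsSaSMovingAverage α P m X)
    (hα0 : 0 < α) (hα2 : α < 2) (hm : MemLp m (ENNReal.ofReal α) volume) (hm0 : ∀ x, 0 ≤ m x) :
    ∃ κ : ℝ, 0 < κ ∧ ∀ t : ℝ, κ * ∫ x, (min (m (-x)) (m (t - x))) ^ α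
        ≤ cov[fun ω ↦ Real.exp (-X 0 ω ^ 2 / 2), fun ω ↦ Real.exp (-X t ω ^ 2 / 2); P] := by
  obtain ⟨κ, hκ, h⟩ := hX.exists_le_covariance_cos hα0 hα2 hm hm0
  set γ := gaussianReal 0 1 with hγ
  set b : ℝ → ℝ := (Icc 1 2).indicator (fun _ ↦ (1 : ℝ)) with hb
  have hbi : Integrable b γ := (integrable_const 1).indicator measurableSet_Icc
  have hbpos : 0 < ∫ s, b s ∂γ := by
    rw [hb, integral_indicator measurableSet_Icc, setIntegral_const, smul_eq_mul, mul_one]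
    refine ENNReal.toReal_pos (fun h0 ↦ ?_) (measure_ne_top _ _)
    have := gaussianReal_absolutelyContinuous' 0 one_ne_zero h0
    simp at this
  refine ⟨(∫ s, b s ∂γ) ^ 2 * κ, by positivity, fun t ↦ ?_⟩
  have hX0 := hX.aemeasurable 0
  have hXt := hX.aemeasurable t
  set J := ∫ x, (min (m (-x)) (m (t - x))) ^ α
  have hK : Measurable (Function.uncurry fun s x : ℝ ↦ Real.cos (s * x)) := by
    simp only [Function.uncurry_def]
    fun_prop
  have h1 : ∀ r : ℝ, _ := fun r ↦ integral_covariance_comp (ρ := γ) (P := P) hK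
    (integrable_const (1 : ℝ)) (fun u x ↦ Real.abs_cos_le_one _) hX0
    (Z := fun ω ↦ Real.cos (r * X t ω)) (D := 1)
    (Real.measurable_cos.comp_aemeasurable (hXt.const_mul r)).aestronglyMeasurable
    (fun ω ↦ Real.abs_cos_le_one _)
  have h2 := integral_covariance_comp (ρ := γ) (P := P) hK
    (integrable_const (1 : ℝ)) (fun u x ↦ Real.abs_cos_le_one _) hXt
    (Z := fun ω ↦ Real.exp (-X 0 ω ^ 2 / 2)) (D := 1)
    (AEMeasurable.aestronglyMeasurable (by fun_prop))
    (fun ω ↦ by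
      rw [Real.abs_exp, Real.exp_le_one_iff]
      linarith [sq_nonneg (X 0 ω)])
  simp only [hγ, integral_cos_mul_gaussianReal] at h1 h2
  rw [← hγ] at h1 h2
  rw [covariance_comm, ← h2.2]
  have h3 : ∀ r, b r * ((∫ s, b s ∂γ) * (κ * J))
      ≤ cov[fun ω ↦ Real.cos (r * X t ω), fun ω ↦ Real.exp (-X 0 ω ^ 2 / 2); P] := by
    intro r
    rw [covariance_comm, ← (h1 r).2]
    have := integral_mono ((hbi.mul_const (b r)).mul_const (κ * J)) (h1 r).1 fun s ↦ h s r t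
    rw [integral_mul_const, integral_mul_const] at this
    linarith
  have h4 := integral_mono (hbi.mul_const _) h2.1 h3
  rw [integral_mul_const] at h4
  linarith

end CosineCovariance

/-! ### From excursion covariances to a smooth covariance -/

section Excursion

variable {Ω : Type*} [MeasurableSpace Ω] {P : Measure Ω} [IsProbabilityMeasure P]

/-- The derivative of `u ↦ exp (-u ^ 2 / 2)`. -/
noncomputable def derivExpNegSqHalf (u : ℝ) : ℝ := -u * Real.exp (-u ^ 2 / 2)

@[fun_prop]
theorem measurable_derivExpNegSqHalf : Measurable derivExpNegSqHalf := by
  unfold derivExpNegSqHalf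
  fun_prop

theorem integrable_derivExpNegSqHalf : Integrable derivExpNegSqHalf :=
  integrable_mul_exp_neg_sq_half

/-- Hoeffding's covariance formula for `exp (-X 0 ^ 2 / 2)` and `exp (-X t ^ 2 / 2)`. -/
theorem integral_excursionCov {X : ℝ → Ω → ℝ} (hX : ∀ t, AEMeasurable (X t) P) (t : ℝ) :
    ∫ v, derivExpNegSqHalf v * ∫ u, derivExpNegSqHalf u * excursionCov P X t u v
      = cov[fun ω ↦ Real.exp (-X 0 ω ^ 2 / 2), fun ω ↦ Real.exp (-X t ω ^ 2 / 2); P] := by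
  have hK : Measurable (Function.uncurry fun u x : ℝ ↦
      derivExpNegSqHalf u * (if u < x then 1 else 0)) := by
    simp only [Function.uncurry_def]
    exact (measurable_derivExpNegSqHalf.comp measurable_fst).mul
      (Measurable.ite (measurableSet_lt measurable_fst measurable_snd) measurable_const
        measurable_const)
  have hKb : ∀ u x : ℝ, |derivExpNegSqHalf u * (if u < x then 1 else 0)|
      ≤ |derivExpNegSqHalf u| := by
    intro u x
    split_ifs <;> simp
  have hind : ∀ t u : ℝ, ({ω | X t ω > u}.indicator fun _ ↦ (1 : ℝ))
      = fun ω ↦ if u < X t ω then (1 : ℝ) else 0 := by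
    intro t u
    funext ω
    simp [indicator_apply]
  have hF : ∀ x : ℝ, ∫ u, derivExpNegSqHalf u * (if u < x then 1 else 0)
      = Real.exp (-x ^ 2 / 2) := integral_indicator_mul_exp_neg_sq_half
  -- The interchange is applied in `u` against the indicator at level `v`, then in `v` against `exp
  -- (-X 0 ^ 2 / 2)`.
  have h1 : ∀ v : ℝ, _ := fun v ↦ integral_covariance_comp (ρ := volume) (P := P) hK
    integrable_derivExpNegSqHalf.abs hKb (hX 0) (Z := fun ω ↦ if v < X t ω then (1 : ℝ) else 0)
    (D := 1)
    ((Measurable.ite measurableSet_Ioi measurable_const measurable_const :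
      Measurable fun x : ℝ ↦ if v < x then (1 : ℝ) else 0).comp_aemeasurable
        (hX t)).aestronglyMeasurable
    (fun ω ↦ by split_ifs <;> simp)
  have h2 := integral_covariance_comp (ρ := volume) (P := P) hK
    integrable_derivExpNegSqHalf.abs hKb (hX t) (Z := fun ω ↦ Real.exp (-X 0 ω ^ 2 / 2))
    (D := 1) (AEMeasurable.aestronglyMeasurable (by have := hX 0; fun_prop))
    (fun ω ↦ by
      rw [Real.abs_exp, Real.exp_le_one_iff]
      linarith [sq_nonneg (X 0 ω)])
  simp only [hF, covariance_const_mul_left] at h1 h2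
  rw [covariance_comm, ← h2.2]
  refine integral_congr_ae (ae_of_all _ fun v ↦ ?_)
  simp only [excursionCov, hind]
  rw [(h1 v).2, covariance_comm]

theorem ofReal_covariance_le_lintegral_excursionCov {X : ℝ → Ω → ℝ}
    (hX : ∀ t, AEMeasurable (X t) P) (t : ℝ) :
    ENNReal.ofReal (cov[fun ω ↦ Real.exp (-X 0 ω ^ 2 / 2),
        fun ω ↦ Real.exp (-X t ω ^ 2 / 2); P])
      ≤ ∫⁻ v, ∫⁻ u, ENNReal.ofReal |excursionCov P X t u v|
          ∂(volume.withDensity fun u ↦ ENNReal.ofReal |derivExpNegSqHalf u|)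
          ∂(volume.withDensity fun u ↦ ENNReal.ofReal |derivExpNegSqHalf u|) := by
  have hd : Measurable fun u ↦ ENNReal.ofReal |derivExpNegSqHalf u| :=
    (continuous_abs.measurable.comp measurable_derivExpNegSqHalf).ennreal_ofReal
  have hd' : ∀ᵐ u : ℝ, ENNReal.ofReal |derivExpNegSqHalf u| < ∞ :=
    ae_of_all _ fun _ ↦ ENNReal.ofReal_lt_top
  have habs : ∀ f : ℝ → ℝ,
      ENNReal.ofReal |∫ x, f x| ≤ ∫⁻ x, ENNReal.ofReal |f x| := by
    intro f
    simpa only [← Real.norm_eq_abs, ofReal_norm] using enorm_integral_le_lintegral_enorm f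
  -- This form needs only a finite measurable density, so no measurability of `excursionCov` in the
  -- levels has to be checked.
  rw [lintegral_withDensity_eq_lintegral_mul_non_measurable _ hd hd', ← integral_excursionCov hX]
  refine (ENNReal.ofReal_le_ofReal (le_abs_self _)).trans ((habs _).trans
    (lintegral_mono fun v ↦ ?_))
  rw [Pi.mul_apply, abs_mul, ENNReal.ofReal_mul (abs_nonneg _)]
  gcongr
  rw [lintegral_withDensity_eq_lintegral_mul_non_measurable _ hd hd']
  refine (habs _).trans (lintegral_mono fun u ↦ ?_)
  rw [Pi.mul_apply, abs_mul, ENNReal.ofReal_mul (abs_nonneg _)]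

end Excursion

/-! ### Divergence of the integrated overlap -/

section Overlap

variable {α : ℝ} {m : ℝ → ℝ}

/-- The overlap `∫ min (m x) (m (t + x)) ^ α dx` of a kernel and its translate. -/
noncomputable def kernelOverlap (α : ℝ) (m : ℝ → ℝ) (t : ℝ) : ℝ≥0∞ :=
  ∫⁻ x, ENNReal.ofReal ((min (m x) (m (t + x))) ^ α)

/-- The substitution `x ↦ -t - x` exchanges the two arguments of the minimum. -/
theorem kernelOverlap_comp_neg (α : ℝ) (m : ℝ → ℝ) (t : ℝ) :
    kernelOverlap α (fun x ↦ m (-x)) t = kernelOverlap α m t := by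
  unfold kernelOverlap
  rw [← lintegral_sub_left_eq_self
    (fun x ↦ ENNReal.ofReal ((min (m (-x)) (m (-(t + x)))) ^ α)) (-t)]
  refine lintegral_congr fun x ↦ ?_
  rw [min_comm]
  congr 3
  · congr 1; ring
  · congr 1; ring

theorem IsSaSMovingAverage.isLongRangeDependent {Ω : Type*} [MeasurableSpace Ω] {P : Measure Ω}
    [IsProbabilityMeasure P] {X : ℝ → Ω → ℝ} (hX : IsSaSMovingAverage α P m X)
    (hα0 : 0 < α) (hα2 : α < 2) (hm : MemLp m (ENNReal.ofReal α) volume) (hm0 : ∀ x, 0 ≤ m x)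
    (h : ∫⁻ t, kernelOverlap α m t = ∞) : IsLongRangeDependent P X := by
  refine ⟨hX.isStationaryProcess hα0 hm,
    volume.withDensity fun u ↦ ENNReal.ofReal |derivExpNegSqHalf u|, ?_, ?_⟩
  · exact isFiniteMeasure_withDensity_ofReal integrable_derivExpNegSqHalf.abs.2
  obtain ⟨κ, hκ, hle⟩ := hX.exists_le_covariance_exp hα0 hα2 hm hm0
  rw [eq_top_iff]
  have htop : ∫⁻ t, ENNReal.ofReal κ * kernelOverlap α m t = ∞ := by
    rw [lintegral_const_mul' _ _ ENNReal.ofReal_ne_top, h,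
      ENNReal.mul_top (by simpa using hκ)]
  rw [← htop]
  refine lintegral_mono fun t ↦ le_trans ?_
    (ofReal_covariance_le_lintegral_excursionCov hX.aemeasurable t)
  refine le_trans (le_of_eq ?_) (ENNReal.ofReal_le_ofReal (hle t))
  have hm1 : MemLp (fun x ↦ m (-x)) (ENNReal.ofReal α) volume := by
    simpa using hm.comp_const_sub 0
  have hint := integrable_min_abs_rpow hα0 hm1
    (hm.comp_const_sub t).aestronglyMeasurable.aemeasurable
  simp only [abs_of_nonneg (hm0 _)] at hint
  rw [ENNReal.ofReal_mul hκ.le, ofReal_integral_eq_lintegral_ofReal hint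
    (ae_of_all _ fun x ↦ Real.rpow_nonneg (le_min (hm0 _) (hm0 _)) _), kernelOverlap,
    ← lintegral_neg_eq_self]
  simp only [sub_eq_add_neg]

/-- For `x > a` both `x` and `t + x` lie where `m` decreases, so the minimum is `m (t + x)`. -/
theorem setLIntegral_Ioi_le_kernelOverlap {a t : ℝ}
    (hanti : AntitoneOn m (Ioi a)) (ht : 0 ≤ t) :
    ∫⁻ x in Ioi (a + t), ENNReal.ofReal (m x ^ α) ≤ kernelOverlap α m t := by
  rw [← lintegral_indicator measurableSet_Ioi,
    ← lintegral_add_left_eq_self _ t]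
  refine lintegral_mono fun x ↦ ?_
  by_cases hx : t + x ∈ Ioi (a + t)
  · rw [indicator_of_mem hx]
    have hxa : a < x := by rw [mem_Ioi] at hx; linarith
    rw [min_eq_right (hanti hxa (show a < t + x by linarith) (by linarith))]
  · rw [indicator_of_notMem hx]
    exact zero_le

theorem lintegral_kernelOverlap_eq_top (hα0 : 0 < α)
    (hm : MemLp m (ENNReal.ofReal α) volume) (hm0 : ∀ x, 0 ≤ m x) {a : ℝ}
    (hanti : AntitoneOn m (Ioi a)) (h : RightMomentInfinite α m a) :
    ∫⁻ t, kernelOverlap α m t = ∞ := by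
  have hmm : AEMeasurable fun x ↦ ENNReal.ofReal (m x ^ α) :=
    (hm.aestronglyMeasurable.aemeasurable.pow_const α).ennreal_ofReal
  have hfin : ∫⁻ x, ENNReal.ofReal (m x ^ α) ≠ ∞ := by
    have := (hm.integrable_abs_rpow hα0).lintegral_lt_top
    simp only [abs_of_nonneg (hm0 _)] at this
    exact this.ne
  have h1 : ∫⁻ z, ENNReal.ofReal (z - a) * ENNReal.ofReal (m z ^ α) ≤ ∫⁻ t, kernelOverlap α m t := by
    have hset : MeasurableSet {p : ℝ × ℝ | 0 < p.1 ∧ a + p.1 < p.2} :=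
      -- Tonelli on this wedge: the section at `z` is `(0, z - a)`, the section at `t > 0` is the
      -- tail `(a + t, ∞)`.
      (measurableSet_lt measurable_const measurable_fst).inter
        (measurableSet_lt (measurable_fst.const_add a) measurable_snd)
    have hmeas : AEMeasurable (Function.uncurry fun t z : ℝ ↦
        {p : ℝ × ℝ | 0 < p.1 ∧ a + p.1 < p.2}.indicator
          (fun p ↦ ENNReal.ofReal (m p.2 ^ α)) (t, z)) (volume.prod volume) :=
      (hmm.comp_snd (μ := volume)).indicator hset
    have e1 : ∀ z : ℝ, ∫⁻ t, {p : ℝ × ℝ | 0 < p.1 ∧ a + p.1 < p.2}.indicator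
          (fun p ↦ ENNReal.ofReal (m p.2 ^ α)) (t, z)
        = ENNReal.ofReal (z - a) * ENNReal.ofReal (m z ^ α) := by
      intro z
      have : (fun t : ℝ ↦ {p : ℝ × ℝ | 0 < p.1 ∧ a + p.1 < p.2}.indicator
          (fun p ↦ ENNReal.ofReal (m p.2 ^ α)) (t, z))
          = (Ioo 0 (z - a)).indicator fun _ ↦ ENNReal.ofReal (m z ^ α) := by
        funext t
        simp only [indicator_apply, mem_ofPred_eq, mem_Ioo, lt_sub_iff_add_lt']
      rw [this, lintegral_indicator measurableSet_Ioo, setLIntegral_const, Real.volume_Ioo,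
        sub_zero, mul_comm]
    simp only [← e1]
    rw [← lintegral_lintegral_swap hmeas]
    refine lintegral_mono fun t ↦ ?_
    by_cases ht : 0 < t
    · refine le_trans (le_of_eq ?_) (setLIntegral_Ioi_le_kernelOverlap hanti ht.le)
      rw [← lintegral_indicator measurableSet_Ioi]
      refine lintegral_congr fun z ↦ ?_
      simp [indicator_apply, ht]
    · simp [ht]
  have h2 : ∫⁻ z, ENNReal.ofReal (z - a) * ENNReal.ofReal (m z ^ α) = ∞ := by
    by_contra hne
    -- Replacing the weight `z` by `z - a` costs only `a * ∫ m^α`, which is finite.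
    have hle : ∫⁻ z in Ioi a, ENNReal.ofReal (z * m z ^ α)
        ≤ (∫⁻ z, ENNReal.ofReal (z - a) * ENNReal.ofReal (m z ^ α))
          + ENNReal.ofReal a * ∫⁻ z, ENNReal.ofReal (m z ^ α) := by
      rw [← lintegral_const_mul' _ _ ENNReal.ofReal_ne_top,
        ← lintegral_add_right' _ (hmm.const_mul _)]
      refine (setLIntegral_le_lintegral _ _).trans (lintegral_mono fun z ↦ ?_)
      rw [← add_mul, ENNReal.ofReal_mul' (Real.rpow_nonneg (hm0 z) _)]
      gcongr
      calc ENNReal.ofReal z = ENNReal.ofReal ((z - a) + a) := by rw [sub_add_cancel]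
        _ ≤ _ := ENNReal.ofReal_add_le
    rw [RightMomentInfinite] at h
    rw [h, top_le_iff] at hle
    exact ENNReal.add_ne_top.2 ⟨hne, ENNReal.mul_ne_top ENNReal.ofReal_ne_top hfin⟩ hle
  rwa [h2, top_le_iff] at h1

theorem rightMomentInfinite_comp_neg (α : ℝ) (m : ℝ → ℝ) (a : ℝ) :
    RightMomentInfinite α (fun x ↦ m (-x)) a ↔ LeftMomentInfinite α m a := by
  rw [RightMomentInfinite, LeftMomentInfinite, ← lintegral_indicator measurableSet_Ioi,
    ← lintegral_indicator measurableSet_Iio, ← lintegral_neg_eq_self]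
  have : ∀ x : ℝ, (Ioi a).indicator (fun t ↦ ENNReal.ofReal (t * m (-t) ^ α)) (-x)
      = (Iio (-a)).indicator (fun t ↦ ENNReal.ofReal (-(t * m t ^ α))) x := by
    intro x
    simp [indicator_apply, lt_neg]
  simp only [this]

end Overlap

theorem mainTheorem6 {Ω : Type*} [MeasurableSpace Ω] (P : Measure Ω) [IsProbabilityMeasure P]
    (α : ℝ) (hα0 : 0 < α) (hα2 : α < 2)
    (m : ℝ → ℝ) (hm : MemLp m (ENNReal.ofReal α) volume) (hm0 : ∀ x, 0 ≤ m x)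
    (X : ℝ → Ω → ℝ) (hX : IsSaSMovingAverage α P m X)
    (a : ℝ) (ha : 0 < a) :
    (AntitoneOn m (Ioi a) → RightMomentInfinite α m a → IsLongRangeDependent P X) ∧
    (MonotoneOn m (Iio (-a)) → LeftMomentInfinite α m a → IsLongRangeDependent P X) ∧
    ((∀ x, m (-x) = m x) → (RightMomentInfinite α m a ↔ LeftMomentInfinite α m a)) := by
  refine ⟨fun hanti h ↦ ?_, fun hmono h ↦ ?_, fun hsymm ↦ ?_⟩
  · exact hX.isLongRangeDependent hα0 hα2 hm hm0
      (lintegral_kernelOverlap_eq_top hα0 hm hm0 hanti h)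
  · refine hX.isLongRangeDependent hα0 hα2 hm hm0 ?_
    -- The reflected kernel has the same overlap and decreases on `(a, ∞)`, which reduces this to
    -- the first case.
    simp only [← kernelOverlap_comp_neg α m]
    refine lintegral_kernelOverlap_eq_top hα0 (by simpa using hm.comp_const_sub 0)
      (fun x ↦ hm0 (-x)) (fun x hx y hy hxy ↦ ?_) ((rightMomentInfinite_comp_neg α m a).2 h)
    exact hmono (mem_Iio.2 (neg_lt_neg hy)) (mem_Iio.2 (neg_lt_neg hx)) (neg_le_neg hxy)
  · rw [← rightMomentInfinite_comp_neg]
    simp only [hsymm]
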